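/- Let $\mathcal M$ be a von Neumann algebra on a complex Hilbert space $\mathcal H$, let $\Omega\in\mathcal H$ be a unit vector that is cyclic for $\mathcal M$, and let $\omega(A)=\langle\Omega,A\Omega\rangle$ $(A\in\mathcal M)$. Let $V$ be a strongly continuous unitary representation of $(\mathbf R^{1+s},+)$ on $\mathcal H$ with self-adjoint generators $H$ (time translations) and $\mathbf P=(P_1,\dots,P_s)$ (space translations), i.e. $V(t,\mathbf x)=e^{i(tH+\mathbf x\mathbf P)}$, normalized so that $H\Omega=P_1\Omega=\dots=P_s\Omega=0$ (so $\omega$ is translation invariant). For a self-adjoint operator $K$ on $\mathcal H$, call $\omega$ passive with respect to $K$ if no cycle performs positive work: for every $T>0$ and every norm-continuously differentiable $h:\mathbf R\to\mathcal M$ with self-adjoint values and $h(t)=0$ for $t\notin[0,T]$, one has $$-\int_0^{T}\langle\psi(t),\dot h(t)\psi(t)\rangle\,dt\le 0,\qquad \psi(t)=e^{-itK}U_h(t)\Omega,$$ where $(U_h(t))_{t\ge0}$ is the unitary evolution solving, in the strong sense, $\frac{d}{dt}U_h(t)=-ie^{itK}h(t)e^{-itK}U_h(t)$, $U_h(0)=1$.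 Suppose that $\omega$ is passive with respect to (the closure of) $\gamma(H+\mathbf v\mathbf P)$, $\gamma=(1-|\mathbf v|^2)^{-1/2}$, for every $\mathbf v\in\mathbf R^s$ with $|\mathbf v|<1$, and that $V(x)\in\mathcal M$ for all $x\in\mathbf R^{1+s}$. Then the joint spectrum of $H$ and $\mathbf P$ (the support of their joint spectral measure) is contained in the closed forward light cone $$V_+=\{(\eta,\mathbf k)\in\mathbf R^{1+s}:\ \eta\ge0,\ \eta^2-\mathbf k^2\ge0\}.$$ -/

import Mathlib

open MeasureTheory Topology
open scoped ComplexInnerProductSpace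

noncomputable section

namespace Passivity

/-- A strongly continuous unitary representation of an additive topological group `G` on `E`. -/
structure UnitaryRep (G E : Type*) [AddGroup G] [TopologicalSpace G]
    [NormedAddCommGroup E] [InnerProductSpace ℂ E] [CompleteSpace E] where
  /-- the operators of the representation -/
  toFun : G → E →L[ℂ] E
  mem_unitary : ∀ x, toFun x ∈ unitary (E →L[ℂ] E)
  map_zero : toFun 0 = 1
  map_add : ∀ x y, toFun (x + y) = toFun x * toFun y
  continuous_apply : ∀ ξ : E, Continuous fun x => toFun x ξ

/-- A projection-valued measure on `X` with values in the orthogonal projections of `E`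
(only the values on measurable sets matter). -/
structure ProjectionValuedMeasure (X E : Type*) [MeasurableSpace X]
    [NormedAddCommGroup E] [InnerProductSpace ℂ E] [CompleteSpace E] where
  /-- the projection assigned to a set -/
  proj : Set X → E →L[ℂ] E
  isStarProjection : ∀ S, MeasurableSet S → IsStarProjection (proj S)
  proj_univ : proj Set.univ = 1
  proj_inter : ∀ S T, MeasurableSet S → MeasurableSet T → proj (S ∩ T) = proj S * proj T
  hasSum_proj : ∀ S : ℕ → Set X, (∀ n, MeasurableSet (S n)) →
    Pairwise (fun m n => Disjoint (S m) (S n)) →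
    ∀ ξ : E, HasSum (fun n => proj (S n) ξ) (proj (⋃ n, S n) ξ)

variable {E : Type*} [NormedAddCommGroup E] [InnerProductSpace ℂ E] [CompleteSpace E]

namespace UnitaryRep

/-- The self-adjoint generator `A` of a one-parameter unitary group `U t = exp (i t A)`:
`A ξ = -i (d/dt) U t ξ` at `t = 0`, defined for those `ξ` for which this derivative exists. -/
def generator (U : UnitaryRep ℝ E) : E →ₗ.[ℂ] E where
  domain :=
    { carrier := {ξ | DifferentiableAt ℝ (fun t => U.toFun t ξ) 0}
      add_mem' := fun {ξ η} hξ hη => by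
        have h : DifferentiableAt ℝ (fun t => U.toFun t ξ + U.toFun t η) 0 := hξ.add hη
        simpa only [Set.mem_ofPred_eq, ContinuousLinearMap.map_add] using h
      zero_mem' := by simp
      smul_mem' := fun c ξ hξ => by
        have h : DifferentiableAt ℝ (fun t => c • U.toFun t ξ) 0 := hξ.const_smul c
        simpa only [Set.mem_ofPred_eq, ContinuousLinearMap.map_smul] using h }
  toFun :=
    { toFun := fun ξ => -Complex.I • deriv (fun t => U.toFun t (ξ : E)) 0
      map_add' := fun ξ η => by
        have h := deriv_add (f := fun t => U.toFun t (ξ : E))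
          (g := fun t => U.toFun t (η : E)) ξ.2 η.2
        have e : (fun t => U.toFun t ((ξ + η : _) : E))
            = (fun t => U.toFun t (ξ : E)) + fun t => U.toFun t (η : E) := by
          funext t; simp
        rw [e, h, smul_add]
      map_smul' := fun c ξ => by
        have h := deriv_const_smul (f := fun t => U.toFun t (ξ : E)) c ξ.2
        have e : (fun t => U.toFun t ((c • ξ : _) : E))
            = fun t => c • U.toFun t (ξ : E) := by
          funext t; simp
        rw [e]
        erw [h]
        simp [smul_comm c Complex.I] }

/-- The one-parameter group `t ↦ V (t • a)` of the representation `V` in the direction `a`. -/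
def along {G : Type*} [AddCommGroup G] [Module ℝ G] [TopologicalSpace G] [ContinuousSMul ℝ G]
    (V : UnitaryRep G E) (a : G) : UnitaryRep ℝ E where
  toFun t := V.toFun (t • a)
  mem_unitary t := V.mem_unitary _
  map_zero := by simp [V.map_zero]
  map_add x y := by rw [add_smul, V.map_add]
  continuous_apply ξ := (V.continuous_apply ξ).comp (by fun_prop)

/-- The generator `H` of the time translations. -/
def hamiltonian {s : ℕ} (V : UnitaryRep (ℝ × EuclideanSpace ℝ (Fin s)) E) : E →ₗ.[ℂ] E :=
  (V.along (1, 0)).generator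

/-- The generator `P j` of the translations in the `j`-th spatial direction. -/
def momentum {s : ℕ} (V : UnitaryRep (ℝ × EuclideanSpace ℝ (Fin s)) E) (j : Fin s) :
    E →ₗ.[ℂ] E :=
  (V.along (0, EuclideanSpace.single j 1)).generator

/-- The self-adjoint operator `γ (H + v P)` with `γ = (1 - |v|²)^(-1/2)`: the closure of
`γ (H + ∑ j, v j P j)` on the intersection of the domains of `H` and all the `P j`. -/
def movingHamiltonian {s : ℕ} (V : UnitaryRep (ℝ × EuclideanSpace ℝ (Fin s)) E)
    (v : EuclideanSpace ℝ (Fin s)) : E →ₗ.[ℂ] E :=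
  (((1 / Real.sqrt (1 - ‖v‖ ^ 2) : ℝ) : ℂ) •
    (V.hamiltonian + ∑ j, ((v j : ℝ) : ℂ) • V.momentum j)).closure

end UnitaryRep

/-- A cycle for the algebra `M` that is switched off outside `[0, T]`: self-adjoint elements
`h t` of `M` that depend on `t` in a norm-continuously differentiable way and vanish for
`t ∉ [0, T]`. -/
structure IsCycle (M : VonNeumannAlgebra E) (T : ℝ) (h : ℝ → E →L[ℂ] E) : Prop where
  mem : ∀ t, h t ∈ M
  selfAdjoint : ∀ t, IsSelfAdjoint (h t)
  contDiff : ContDiff ℝ 1 h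
  eq_zero : ∀ t, t ∉ Set.Icc 0 T → h t = 0

/-- `W` is the perturbed unitary evolution (in the interaction picture) of the cycle `h` with
respect to the free dynamics `U t = exp (i t K)`:
`W 0 = 1` and `(d/dt) W t = -i U(t) h(t) U(-t) W(t)` for `t ≥ 0`, in the strong sense. -/
structure IsPerturbedEvolution (U : UnitaryRep ℝ E) (h W : ℝ → E →L[ℂ] E) : Prop where
  mem_unitary : ∀ t, 0 ≤ t → W t ∈ unitary (E →L[ℂ] E)
  initial : W 0 = 1
  hasDeriv : ∀ ξ : E, ∀ t, 0 ≤ t →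
    HasDerivWithinAt (fun r => W r ξ)
      (-Complex.I • U.toFun t (h t (U.toFun (-t) (W t ξ)))) (Set.Ici 0) t

/-- The work `∫₀ᵀ ⟨ψ t, h' t ψ t⟩ dt` required for a cycle, where `ψ t = U(-t) W(t) Ω`.
For a cycle the integrand is real and continuous, and the integral does not depend on the choice
of `T` as long as `h` vanishes outside `[0, T]`. -/
def work (U : UnitaryRep ℝ E) (Ω : E) (T : ℝ) (h W : ℝ → E →L[ℂ] E) : ℝ :=
  ∫ t in (0 : ℝ)..T, (⟪U.toFun (-t) (W t Ω), deriv h t (U.toFun (-t) (W t Ω))⟫).re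

/-- The state `A ↦ ⟨Ω, A Ω⟩` of `M` is passive with respect to the Hamiltonian `K`: with the
dynamics `U t = exp (i t K)` (the unitary group generated by `K`), no cycle performs positive
work. -/
def IsPassive (M : VonNeumannAlgebra E) (Ω : E) (K : E →ₗ.[ℂ] E) : Prop :=
  ∀ U : UnitaryRep ℝ E, U.generator = K →
    ∀ (T : ℝ) (h W : ℝ → E →L[ℂ] E), 0 < T → IsCycle M T h → IsPerturbedEvolution U h W →
      -work U Ω T h W ≤ 0

namespace ProjectionValuedMeasure

variable {X : Type*} [MeasurableSpace X]

lemma proj_empty (F : ProjectionValuedMeasure X E) : F.proj ∅ = 0 := by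
  ext ξ
  have h := F.hasSum_proj (fun _ => ∅) (fun _ => MeasurableSet.empty)
    (fun _ _ _ => disjoint_bot_left) ξ
  simpa using tendsto_nhds_unique tendsto_const_nhds h.summable.tendsto_atTop_zero

lemma re_inner_nonneg (F : ProjectionValuedMeasure X E) (ξ : E) {S : Set X}
    (hS : MeasurableSet S) : 0 ≤ (⟪ξ, F.proj S ξ⟫).re := by
  have hp := F.isStarProjection S hS
  have e : ⟪ξ, F.proj S ξ⟫ = ⟪F.proj S ξ, F.proj S ξ⟫ := by
    rw [← ContinuousLinearMap.adjoint_inner_right, ← ContinuousLinearMap.star_eq_adjoint,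
      hp.isSelfAdjoint.star_eq, ← mul_apply_eq_comp, hp.isIdempotentElem.eq]
  rw [e]
  exact inner_self_nonneg (𝕜 := ℂ)

/-- The finite measure `S ↦ ⟨ξ, F(S) ξ⟩`. -/
def scalarMeasure (F : ProjectionValuedMeasure X E) (ξ : E) : Measure X :=
  Measure.ofMeasurable (fun S _ => ENNReal.ofReal (⟪ξ, F.proj S ξ⟫).re)
    (by simp [F.proj_empty])
    (fun S hS hd => by
      have h1 := F.hasSum_proj S hS hd ξ
      have h2 : HasSum (fun n => (⟪ξ, F.proj (S n) ξ⟫).re) (⟪ξ, F.proj (⋃ n, S n) ξ⟫).re :=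
        ((Complex.reCLM.comp ((innerSL ℂ ξ).restrictScalars ℝ)).hasSum h1)
      rw [← h2.tsum_eq]
      exact ENNReal.ofReal_tsum_of_nonneg (fun n => F.re_inner_nonneg ξ (hS n)) h2.summable)

/-- `A = ∫ f dF`: the domain of `A` consists of the `ξ` with `∫ f² d⟨ξ, F ξ⟩ < ∞`, and
`⟨ξ, A ξ⟩ = ∫ f d⟨ξ, F ξ⟩` for these `ξ`. -/
def Represents (F : ProjectionValuedMeasure X E) (f : X → ℝ) (A : E →ₗ.[ℂ] E) : Prop :=
  (∀ ξ, ξ ∈ A.domain ↔ Integrable (fun p => f p ^ 2) (F.scalarMeasure ξ)) ∧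
  ∀ ξ : A.domain, ⟪(ξ : E), A ξ⟫ = ((∫ p, f p ∂F.scalarMeasure (ξ : E) : ℝ) : ℂ)

/-- The support of a projection-valued measure. -/
def support [TopologicalSpace X] (F : ProjectionValuedMeasure X E) : Set X :=
  {p | ∀ S, IsOpen S → p ∈ S → F.proj S ≠ 0}

end ProjectionValuedMeasure

/-- `F` is the joint spectral measure (the product of the spectral measures) of the strongly
commuting self-adjoint operators `H, P 1, …, P s`: it is a projection-valued measure on
`ℝ × ℝˢ` whose marginals are the spectral measures of `H` and of the `P j`. -/
structure IsJointSpectralMeasure {s : ℕ} (H : E →ₗ.[ℂ] E) (P : Fin s → E →ₗ.[ℂ] E)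
    (F : ProjectionValuedMeasure (ℝ × EuclideanSpace ℝ (Fin s)) E) : Prop where
  energy : F.Represents (fun p => p.1) H
  momentum : ∀ j, F.Represents (fun p => p.2 j) (P j)

/-- The joint spectrum of strongly commuting self-adjoint operators `H, P 1, …, P s`: the support
of their joint spectral measure, which exists and is unique by the spectral theorem. -/
def jointSpectrum {s : ℕ} (H : E →ₗ.[ℂ] E) (P : Fin s → E →ₗ.[ℂ] E) :
    Set (ℝ × EuclideanSpace ℝ (Fin s)) :=
  {p | ∃ F : ProjectionValuedMeasure (ℝ × EuclideanSpace ℝ (Fin s)) E,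
    IsJointSpectralMeasure H P F ∧ p ∈ F.support}

/-- The closed forward light cone. -/
def forwardCone (s : ℕ) : Set (ℝ × EuclideanSpace ℝ (Fin s)) :=
  {p | 0 ≤ p.1 ∧ 0 ≤ p.1 ^ 2 - ‖p.2‖ ^ 2}

/-- `Ω` is a cyclic vector of `M`. -/
def IsCyclic (M : VonNeumannAlgebra E) (Ω : E) : Prop :=
  Dense {ξ : E | ∃ A ∈ M, A Ω = ξ}

end Passivity

end

open Passivity

open MeasureTheory Topology Filter
open scoped ComplexInnerProductSpace

namespace Passivity

variable {E : Type*} [NormedAddCommGroup E] [InnerProductSpace ℂ E] [CompleteSpace E]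

/-! Fix a velocity `v` with `‖v‖ < 1` and let `K` generate `U t = V (t • velocity v)`. Everything
rests on `IsPassive.generator_nonneg`: passivity with respect to `K`, together with `U t ∈ M`,
forces `K ≥ 0`. A point of the joint spectrum outside the cone would give, for a suitable `v`, a
vector on which `K` has negative expectation (`IsJointSpectralMeasure.exists_mem_graph`).

Positivity comes from second-order response. For self-adjoint `B ∈ M` that is C¹ in norm under the
dynamics, a smooth step cycle steers `Ω` to `exp (-icB) Ω`. The work is nonnegative for every real
`c`, and its second derivative at `c = 0` gives `⟪BΩ, K BΩ⟫ ≥ 0` (`IsPassive.im_inner_le`). Vectors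
`BΩ` with `B` self-adjoint are too few, but if `A* Ω = 0` then `(A + A*) Ω = AΩ`. Since the dynamics
is inner, `A = (1 - U t) C` with `C ∈ M` is available, and cyclicity yields `⟪(1 - U t) ξ, K (1 - U
t) ξ⟫ ≥ 0` on the whole domain of `K`. Averaging over `t` removes the cross terms
(`UnitaryRep.im_inner_nonneg_of_forall`).

Domain questions are handled by smearing `V` with bump functions: the resulting operators lie in
`M`, fix `Ω`, tend strongly to `1` and map into the domains of all generators. -/

/-- A strongly differentiable family of operators whose derivative is norm-continuous is
norm-differentiable. -/
lemma hasDerivAt_of_forall_apply {L D : ℝ → E →L[ℂ] E} (hD : Continuous D)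
    (h : ∀ ξ t, HasDerivAt (fun t => L t ξ) (D t ξ) t) (t : ℝ) : HasDerivAt L (D t) t := by
  have e : L = fun t => L 0 + ∫ r in (0 : ℝ)..t, D r := by
    funext t
    ext ξ
    have h1 : (∫ r in (0 : ℝ)..t, D r) ξ = ∫ r in (0 : ℝ)..t, D r ξ :=
      ContinuousLinearMap.intervalIntegral_apply (hD.intervalIntegrable 0 t) ξ
    have h2 : ∫ r in (0 : ℝ)..t, D r ξ = L t ξ - L 0 ξ :=
      intervalIntegral.integral_eq_sub_of_hasDerivAt (fun r _ => h ξ r)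
        ((hD.clm_apply continuous_const).intervalIntegrable 0 t)
    simp [h1, h2]
  rw [e]
  exact (intervalIntegral.integral_hasDerivAt_right (hD.intervalIntegrable 0 t)
    hD.aestronglyMeasurable.stronglyMeasurableAtFilter hD.continuousAt).const_add _

/-! ### Unitary representations and smoothing by convolution -/

namespace UnitaryRep

section Group

variable {G : Type*} [AddCommGroup G] [TopologicalSpace G] (V : UnitaryRep G E)

@[simp]
lemma norm_apply (x : G) (ξ : E) : ‖V.toFun x ξ‖ = ‖ξ‖ :=
  ContinuousLinearMap.norm_map_of_mem_unitary (V.mem_unitary x) ξ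

@[simp]
lemma inner_apply_apply (x : G) (ξ η : E) : ⟪V.toFun x ξ, V.toFun x η⟫ = ⟪ξ, η⟫ :=
  ContinuousLinearMap.inner_map_map_of_mem_unitary (V.mem_unitary x) ξ η

lemma add_apply (x y : G) (ξ : E) : V.toFun (x + y) ξ = V.toFun x (V.toFun y ξ) := by
  rw [V.map_add]; rfl

@[simp]
lemma apply_neg_apply (x : G) (ξ : E) : V.toFun x (V.toFun (-x) ξ) = ξ := by
  rw [← V.add_apply, add_neg_cancel, V.map_zero]; rfl

@[simp]
lemma neg_apply_apply (x : G) (ξ : E) : V.toFun (-x) (V.toFun x ξ) = ξ := by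
  rw [← V.add_apply, neg_add_cancel, V.map_zero]; rfl

lemma apply_comm (x y : G) (ξ : E) :
    V.toFun x (V.toFun y ξ) = V.toFun y (V.toFun x ξ) := by
  rw [← V.add_apply, add_comm, V.add_apply]

lemma inner_apply_left (x : G) (ξ η : E) : ⟪V.toFun x ξ, η⟫ = ⟪ξ, V.toFun (-x) η⟫ := by
  rw [← V.inner_apply_apply (-x), V.neg_apply_apply]

lemma star_toFun (x : G) : star (V.toFun x) = V.toFun (-x) := by
  rw [ContinuousLinearMap.star_eq_adjoint]
  symm
  rw [ContinuousLinearMap.eq_adjoint_iff]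
  intro ξ η
  rw [V.inner_apply_left, neg_neg]

lemma continuous_uncurry : Continuous fun p : G × E => V.toFun p.1 p.2 := by
  rw [continuous_iff_continuousAt]
  rintro ⟨x, ξ⟩
  rw [ContinuousAt, tendsto_iff_norm_sub_tendsto_zero]
  have h1 : Tendsto (fun p : G × E => ‖p.2 - ξ‖ + ‖V.toFun p.1 ξ - V.toFun x ξ‖) (𝓝 (x, ξ))
      (𝓝 0) := by
    have hc : Continuous fun p : G × E => ‖p.2 - ξ‖ + ‖V.toFun p.1 ξ - V.toFun x ξ‖ :=
      (continuous_snd.sub continuous_const).norm.add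
        (((V.continuous_apply ξ).comp continuous_fst).sub continuous_const).norm
    simpa using hc.tendsto (x, ξ)
  refine squeeze_zero (fun _ => norm_nonneg _) (fun p => ?_) h1
  calc ‖V.toFun p.1 p.2 - V.toFun x ξ‖
      = ‖V.toFun p.1 (p.2 - ξ) + (V.toFun p.1 ξ - V.toFun x ξ)‖ := by
        rw [_root_.map_sub]; congr 1; abel
    _ ≤ _ := (norm_add_le _ _).trans (by rw [V.norm_apply])

end Group

section Smear

variable {G : Type*} [NormedAddCommGroup G] [MeasurableSpace G] [BorelSpace G] (μ : Measure G) [μ.IsAddHaarMeasure]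
  (V : UnitaryRep G E)

lemma integrable_smul_apply {φ : G → ℝ} (hφ : Continuous φ) (hc : HasCompactSupport φ) (ξ : E) :
    Integrable (fun x => φ x • V.toFun (-x) ξ) μ :=
  (hφ.smul ((V.continuous_apply ξ).comp continuous_neg)).integrable_of_hasCompactSupport
    hc.smul_right

/-- The smeared operator `∫ φ(x) V(-x) dx`. -/
noncomputable def smear (φ : G → ℝ) (hφ : Continuous φ) (hc : HasCompactSupport φ) : E →L[ℂ] E :=
  LinearMap.mkContinuous
    { toFun := fun ξ => ∫ x, φ x • V.toFun (-x) ξ ∂μ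
      map_add' := fun ξ η => by
        rw [← integral_add (V.integrable_smul_apply μ hφ hc ξ) (V.integrable_smul_apply μ hφ hc η)]
        simp
      map_smul' := fun c ξ => by
        rw [RingHom.id_apply, ← integral_smul]
        simp [smul_comm c] }
    (∫ x, ‖φ x‖ ∂μ) (fun ξ => by
      refine (norm_integral_le_integral_norm _).trans (le_of_eq ?_)
      simp_rw [norm_smul, V.norm_apply]
      exact integral_mul_const _ _)

variable {φ : G → ℝ} (hφ : Continuous φ) (hc : HasCompactSupport φ)

lemma smear_apply (ξ : E) : V.smear μ φ hφ hc ξ = ∫ x, φ x • V.toFun (-x) ξ ∂μ := rfl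

/-- This puts smeared operators into the double commutant of the representation, hence into `M`. -/
lemma smear_comm {C : E →L[ℂ] E} (hC : ∀ x, C * V.toFun x = V.toFun x * C) :
    C * V.smear μ φ hφ hc = V.smear μ φ hφ hc * C := by
  ext ξ
  change C (V.smear μ φ hφ hc ξ) = V.smear μ φ hφ hc (C ξ)
  rw [smear_apply, smear_apply,
    ← ContinuousLinearMap.integral_comp_comm C (V.integrable_smul_apply μ hφ hc ξ)]
  congr 1
  funext x
  have h := DFunLike.congr_fun (hC (-x)) ξ
  change C (V.toFun (-x) ξ) = V.toFun (-x) (C ξ) at h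
  rw [← h, ← Complex.coe_smul, ← Complex.coe_smul, _root_.map_smul]

/-- Orbits of smeared vectors are convolutions with `φ`, so they inherit its smoothness; this
dictates the sign in `V(-x)`. -/
lemma apply_smear (y : G) (ξ : E) : V.toFun y (V.smear μ φ hφ hc ξ)
    = convolution φ (fun x => V.toFun x ξ) (ContinuousLinearMap.lsmul ℝ ℝ) μ y := by
  rw [smear_apply,
    ← ContinuousLinearMap.integral_comp_comm _ (V.integrable_smul_apply μ hφ hc ξ)]
  unfold convolution
  congr 1
  funext x
  rw [ContinuousLinearMap.lsmul_apply, sub_eq_add_neg]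
  change _ = φ x • V.toFun (y + -x) ξ
  rw [V.add_apply, ← Complex.coe_smul,
    ← Complex.coe_smul, _root_.map_smul]

/-- Smoothing operators in the double commutant of a strongly continuous representation. -/
lemma exists_smoothing [NormedSpace ℝ G] [FiniteDimensional ℝ G] : ∃ R : ℕ → E →L[ℂ] E,
    (∀ n (C : E →L[ℂ] E), (∀ x, C * V.toFun x = V.toFun x * C) → C * R n = R n * C) ∧
    (∀ n ξ, Differentiable ℝ fun x => V.toFun x (R n ξ)) ∧
    (∀ n ξ, (∀ x, V.toFun x ξ = ξ) → R n ξ = ξ) ∧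
    ∀ ξ, Tendsto (fun n => R n ξ) atTop (𝓝 ξ) := by
  let μ : Measure G := Measure.addHaar
  let b : ℕ → ContDiffBump (0 : G) := fun n =>
    ⟨1 / ((n : ℝ) + 1) / 2, 1 / ((n : ℝ) + 1), by positivity,
      half_lt_self (by positivity)⟩
  have hb : Tendsto (fun n => (b n).rOut) atTop (𝓝 0) := tendsto_one_div_add_atTop_nhds_zero_nat
  refine ⟨fun n => V.smear μ ((b n).normed μ) (b n).continuous_normed
    (b n).hasCompactSupport_normed, fun n C hC => V.smear_comm μ _ _ hC, fun n ξ => ?_,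
    fun n ξ hξ => ?_, fun ξ => ?_⟩
  · simp_rw [apply_smear]
    exact ((b n).hasCompactSupport_normed.contDiff_convolution_left (n := 1)
      (ContinuousLinearMap.lsmul ℝ ℝ) (b n).contDiff_normed
      (V.continuous_apply ξ).locallyIntegrable).differentiable (by simp)
  · rw [smear_apply]
    simp_rw [hξ]
    rw [integral_smul_const, (b n).integral_normed, one_smul]
  · have h := ContDiffBump.convolution_tendsto_right_of_continuous (μ := μ) hb
      (V.continuous_apply ξ) 0
    simp_rw [← V.apply_smear μ (b _).continuous_normed (b _).hasCompactSupport_normed] at h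
    simpa [V.map_zero] using h

end Smear

end UnitaryRep

/-! ### Generators of one-parameter groups -/

namespace UnitaryRep

lemma mem_generator_graph (U : UnitaryRep ℝ E) {ξ y : E} :
    (ξ, y) ∈ U.generator.graph ↔ HasDerivAt (fun t => U.toFun t ξ) (Complex.I • y) 0 := by
  rw [LinearPMap.mem_graph_iff]
  constructor
  · rintro ⟨x, hx, hy⟩
    simp only at hx hy
    have hd : DifferentiableAt ℝ (fun t => U.toFun t (x : E)) 0 := x.2
    have hy' : -Complex.I • deriv (fun t => U.toFun t (x : E)) 0 = y := hy
    rw [← hy', smul_smul, ← hx]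
    simpa using hd.hasDerivAt
  · intro h
    refine ⟨⟨ξ, h.differentiableAt⟩, rfl, ?_⟩
    change -Complex.I • deriv (fun t => U.toFun t ξ) 0 = y
    rw [h.deriv, smul_smul]
    simp

lemma hasDerivAt_of_zero (U : UnitaryRep ℝ E) {ξ y : E}
    (h : HasDerivAt (fun t => U.toFun t ξ) y 0) (t : ℝ) :
    HasDerivAt (fun t => U.toFun t ξ) (U.toFun t y) t := by
  have h1 : HasDerivAt (fun r => U.toFun (r - t) ξ) y t := by
    have h' : HasDerivAt (fun t => U.toFun t ξ) y (t - t) := by rwa [sub_self]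
    simpa using h'.comp_sub_const t t
  have h2 := ((U.toFun t).restrictScalars ℝ).hasFDerivAt.comp_hasDerivAt t h1
  refine h2.congr_of_eventuallyEq (Eventually.of_forall fun r => ?_)
  change U.toFun r ξ = U.toFun t (U.toFun (r - t) ξ)
  rw [← U.add_apply, add_sub_cancel]

lemma apply_eq_of_hasDerivAt_zero (U : UnitaryRep ℝ E) {ξ : E}
    (h : HasDerivAt (fun t => U.toFun t ξ) 0 0) (t : ℝ) : U.toFun t ξ = ξ := by
  have h1 := is_const_of_deriv_eq_zero (f := fun t => U.toFun t ξ)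
    (fun t => (U.hasDerivAt_of_zero h t).differentiableAt)
    (fun t => by rw [(U.hasDerivAt_of_zero h t).deriv]; simp) t 0
  simpa [U.map_zero] using h1

/-- A bounded operator commuting with the group commutes with its generator. -/
lemma hasDerivAt_comp (U : UnitaryRep ℝ E) {R : E →L[ℂ] E}
    (hR : ∀ t ξ, R (U.toFun t ξ) = U.toFun t (R ξ)) {ξ y : E}
    (h : HasDerivAt (fun t => U.toFun t ξ) y 0) :
    HasDerivAt (fun t => U.toFun t (R ξ)) (R y) 0 := by
  have h2 := (R.restrictScalars ℝ).hasFDerivAt.comp_hasDerivAt (0 : ℝ) h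
  refine h2.congr_of_eventuallyEq (Eventually.of_forall fun r => ?_)
  exact (hR r ξ).symm

/-- The integrated form is a closed condition on the pair `(ξ, y)`, which makes the generator
closed. -/
lemma hasDerivAt_iff_forall_integral (U : UnitaryRep ℝ E) {ξ y : E} :
    HasDerivAt (fun t => U.toFun t ξ) y 0 ↔
      ∀ t, U.toFun t ξ - ξ = ∫ r in (0 : ℝ)..t, U.toFun r y := by
  have hc := U.continuous_apply y
  constructor
  · intro h t
    rw [intervalIntegral.integral_eq_sub_of_hasDerivAt
      (fun r _ => U.hasDerivAt_of_zero h r) (hc.intervalIntegrable 0 t), U.map_zero]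
    rfl
  · intro h
    have h1 := (intervalIntegral.integral_hasDerivAt_right (hc.intervalIntegrable 0 0)
      hc.aestronglyMeasurable.stronglyMeasurableAtFilter hc.continuousAt).const_add ξ
    rw [U.map_zero, one_apply_eq_self] at h1
    refine h1.congr_of_eventuallyEq (Eventually.of_forall fun r => ?_)
    simp [← h r]

lemma isClosed_generator (U : UnitaryRep ℝ E) : U.generator.IsClosed := by
  have e : (U.generator.graph : Set (E × E)) = ⋂ t : ℝ, {p : E × E |
      U.toFun t p.1 - p.1 = ∫ r in (0 : ℝ)..t, U.toFun r (Complex.I • p.2)} := by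
    ext p
    simp only [SetLike.mem_coe, Set.mem_iInter]
    exact U.mem_generator_graph.trans U.hasDerivAt_iff_forall_integral
  change IsClosed (U.generator.graph : Set (E × E))
  rw [e]
  refine isClosed_iInter fun t => isClosed_eq (by fun_prop) ?_
  refine intervalIntegral.continuous_parametric_intervalIntegral_of_continuous' ?_ 0 t
  exact U.continuous_uncurry.comp
    (continuous_snd.prodMk (continuous_const.smul (continuous_snd.comp continuous_fst)))

section Module

variable {G : Type*} [AddCommGroup G] [Module ℝ G] [TopologicalSpace G]
  (V : UnitaryRep G E)

lemma hasDerivAt_along_smul {a : G} {ξ y : E} (c : ℝ)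
    (h : HasDerivAt (fun t : ℝ => V.toFun (t • a) ξ) y 0) :
    HasDerivAt (fun t : ℝ => V.toFun (t • c • a) ξ) (c • y) 0 := by
  have h' : HasDerivAt (fun t : ℝ => V.toFun (t • a) ξ) y ((0 : ℝ) * c) := by rwa [zero_mul]
  have h2 := h'.scomp (0 : ℝ) ((hasDerivAt_id (0 : ℝ)).mul_const c)
  simpa [Function.comp_def, mul_smul] using h2

variable [ContinuousSMul ℝ G]

lemma along_toFun (a : G) (t : ℝ) : (V.along a).toFun t = V.toFun (t • a) := rfl

/-- Product rule for `V(ta) V(tb)`: the difference quotient in direction `b` is still hit by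
`V(ta)`, and joint continuity of `(x, ξ) ↦ V(x) ξ` lets it pass to the limit. -/
lemma hasDerivAt_along_add {a b : G} {ξ y z : E}
    (ha : HasDerivAt (fun t : ℝ => V.toFun (t • a) ξ) y 0)
    (hb : HasDerivAt (fun t : ℝ => V.toFun (t • b) ξ) z 0) :
    HasDerivAt (fun t : ℝ => V.toFun (t • (a + b)) ξ) (y + z) 0 := by
  rw [hasDerivAt_iff_tendsto_slope_zero] at ha hb ⊢
  have h0 : Tendsto (fun t : ℝ => t • a) (𝓝[≠] 0) (𝓝 0) := by
    have h : Continuous fun t : ℝ => t • a := by fun_prop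
    simpa using (h.tendsto 0).mono_left nhdsWithin_le_nhds
  have h1 := (V.continuous_uncurry.tendsto (0, z)).comp (h0.prodMk_nhds hb)
  have h2 : Tendsto (fun t : ℝ => V.toFun (t • a) (t⁻¹ • (V.toFun (t • b) ξ - ξ))) (𝓝[≠] 0)
      (𝓝 z) := by
    simpa [Function.comp_def, V.map_zero] using h1
  refine (ha.add h2).congr' ?_
  · refine Eventually.of_forall fun t => ?_
    simp only [zero_add, zero_smul, V.map_zero, one_apply_eq_self, smul_add,
      V.add_apply]
    rw [← Complex.coe_smul t⁻¹ (V.toFun (t • b) ξ - ξ), _root_.map_smul, Complex.coe_smul,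
      ← smul_add, _root_.map_sub]
    congr 1
    abel

lemma hasDerivAt_along_sum {ι : Type*} (S : Finset ι) {a : ι → G} {ξ : E} {y : ι → E}
    (h : ∀ i ∈ S, HasDerivAt (fun t : ℝ => V.toFun (t • a i) ξ) (y i) 0) :
    HasDerivAt (fun t : ℝ => V.toFun (t • ∑ i ∈ S, a i) ξ) (∑ i ∈ S, y i) 0 := by
  classical
  induction S using Finset.induction_on with
  | empty => simpa using hasDerivAt_const (0 : ℝ) (V.toFun 0 ξ)
  | insert i S hi ih =>
    rw [Finset.sum_insert hi, Finset.sum_insert hi]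
    exact V.hasDerivAt_along_add (h i (Finset.mem_insert_self i S))
      (ih fun j hj => h j (Finset.mem_insert_of_mem hj))

end Module

end UnitaryRep

/-! ### Graphs of sums and multiples of unbounded operators -/

section Graph

variable {F : Type*} [NormedAddCommGroup F] [InnerProductSpace ℂ F]

lemma mem_add_graph {S T : F →ₗ.[ℂ] F} {p : F × F} :
    p ∈ (S + T).graph ↔ ∃ y z, (p.1, y) ∈ S.graph ∧ (p.1, z) ∈ T.graph ∧ y + z = p.2 := by
  simp only [LinearPMap.mem_graph_iff]
  constructor
  · rintro ⟨x, hx, hy⟩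
    exact ⟨S ⟨x, x.2.1⟩, T ⟨x, x.2.2⟩, ⟨_, hx, rfl⟩, ⟨_, hx, rfl⟩, hy⟩
  · rintro ⟨y, z, ⟨u, hu, rfl⟩, ⟨w, hw, rfl⟩, h⟩
    refine ⟨⟨p.1, hu ▸ u.2, hw ▸ w.2⟩, rfl, ?_⟩
    rw [← h, LinearPMap.add_apply]
    congr 2 <;> exact Subtype.ext (by simp_all)

lemma mem_smul_graph {c : ℂ} {T : F →ₗ.[ℂ] F} {p : F × F} :
    p ∈ (c • T).graph ↔ ∃ y, (p.1, y) ∈ T.graph ∧ c • y = p.2 := by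
  simp only [LinearPMap.mem_graph_iff]
  constructor
  · rintro ⟨x, hx, hy⟩
    exact ⟨T x, ⟨x, hx, rfl⟩, hy⟩
  · rintro ⟨y, ⟨u, hu, rfl⟩, h⟩
    exact ⟨u, hu, h⟩

lemma mem_sum_graph {ι : Type*} (S : Finset ι) {T : ι → F →ₗ.[ℂ] F} {p : F × F} :
    p ∈ (∑ i ∈ S, T i).graph ↔
      ∃ y : ι → F, (∀ i ∈ S, (p.1, y i) ∈ (T i).graph) ∧ ∑ i ∈ S, y i = p.2 := by
  classical
  induction S using Finset.induction_on generalizing p with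
  | empty =>
    simp only [Finset.sum_empty, LinearPMap.mem_graph_iff]
    constructor
    · rintro ⟨x, -, hy⟩
      exact ⟨0, by simp, hy⟩
    · rintro ⟨-, -, h⟩
      exact ⟨⟨p.1, trivial⟩, rfl, h⟩
  | insert i S hi ih =>
    rw [Finset.sum_insert hi, mem_add_graph]
    constructor
    · rintro ⟨y, z, hy, hz, h⟩
      obtain ⟨w, hw, hw'⟩ := ih.1 hz
      refine ⟨Function.update w i y, fun j hj => ?_, ?_⟩
      · by_cases hji : j = i
        · subst hji; simpa using hy
        · simpa [hji] using hw j (Finset.mem_of_mem_insert_of_ne hj hji)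
      · rw [Finset.sum_insert hi, Function.update_self, ← h]
        congr 1
        refine Eq.trans (Finset.sum_congr rfl fun j hj => ?_) hw'
        rw [Function.update_of_ne]
        rintro rfl
        exact hi hj
    · rintro ⟨y, hy, h⟩
      refine ⟨y i, ∑ j ∈ S, y j, hy i (Finset.mem_insert_self i S),
        ih.2 ⟨y, fun j hj => hy j (Finset.mem_insert_of_mem hj), rfl⟩, ?_⟩
      rw [← h, Finset.sum_insert hi]

end Graph

/-! ### The moving Hamiltonian as a generator -/

namespace UnitaryRep

variable {s : ℕ} (V : UnitaryRep (ℝ × EuclideanSpace ℝ (Fin s)) E)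

lemma eq_add_sum_smul_single (t : ℝ) (v : EuclideanSpace ℝ (Fin s)) :
    ((t, v) : ℝ × EuclideanSpace ℝ (Fin s)) = t • ((1 : ℝ), (0 : EuclideanSpace ℝ (Fin s)))
      + ∑ j, v j • ((0 : ℝ), (EuclideanSpace.single j (1 : ℝ))) := by
  have h : ∑ j, v j • EuclideanSpace.single j (1 : ℝ) = v := by
    ext i
    simp [Pi.single_apply]
  ext1
  · simp [Prod.fst_sum]
  · simp [Prod.snd_sum, h]

/-- The operator `γ (H + v P)` before taking the closure. -/
noncomputable def preMovingHamiltonian (v : EuclideanSpace ℝ (Fin s)) : E →ₗ.[ℂ] E :=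
  ((1 / Real.sqrt (1 - ‖v‖ ^ 2) : ℝ) : ℂ) •
    (V.hamiltonian + ∑ j, ((v j : ℝ) : ℂ) • V.momentum j)

/-- The velocity vector `γ (1, v)`. -/
noncomputable def velocity (v : EuclideanSpace ℝ (Fin s)) : ℝ × EuclideanSpace ℝ (Fin s) :=
  (1 / Real.sqrt (1 - ‖v‖ ^ 2)) • (1, v)

lemma mem_preMovingHamiltonian_graph {v : EuclideanSpace ℝ (Fin s)} {p : E × E} :
    p ∈ (V.preMovingHamiltonian v).graph ↔ ∃ (y : E) (z : Fin s → E),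
      (p.1, y) ∈ V.hamiltonian.graph ∧ (∀ j, (p.1, z j) ∈ (V.momentum j).graph) ∧
      ((1 / Real.sqrt (1 - ‖v‖ ^ 2) : ℝ) : ℂ) • (y + ∑ j, ((v j : ℝ) : ℂ) • z j) = p.2 := by
  unfold preMovingHamiltonian
  simp only [mem_smul_graph, mem_add_graph, mem_sum_graph]
  constructor
  · rintro ⟨_, ⟨y, _, hy, ⟨w, hw, rfl⟩, rfl⟩, h⟩
    choose z hz hz' using fun j => hw j (Finset.mem_univ j)
    refine ⟨y, z, hy, hz, ?_⟩
    simp_rw [hz', h]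
  · rintro ⟨y, z, hy, hz, h⟩
    exact ⟨_, ⟨y, _, hy, ⟨_, fun j _ => ⟨z j, hz j, rfl⟩, rfl⟩, rfl⟩, h⟩

lemma preMovingHamiltonian_le (v : EuclideanSpace ℝ (Fin s)) :
    V.preMovingHamiltonian v ≤ (V.along (velocity v)).generator := by
  rw [← LinearPMap.le_graph_iff]
  rintro ⟨ξ, x⟩ hx
  obtain ⟨y, z, hy, hz, h⟩ := V.mem_preMovingHamiltonian_graph.1 hx
  simp only at hy hz h
  have hy' : HasDerivAt (fun t : ℝ => V.toFun (t • (1, 0)) ξ) (Complex.I • y) 0 :=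
    (mem_generator_graph _).1 hy
  have hz' : ∀ j, HasDerivAt (fun t : ℝ => V.toFun (t • (0, EuclideanSpace.single j 1)) ξ)
      (Complex.I • z j) 0 := fun j => (mem_generator_graph _).1 (hz j)
  have h1 := V.hasDerivAt_along_smul (1 / Real.sqrt (1 - ‖v‖ ^ 2))
    (V.hasDerivAt_along_add (V.hasDerivAt_along_smul 1 hy')
      (V.hasDerivAt_along_sum Finset.univ fun j _ => V.hasDerivAt_along_smul (v j) (hz' j)))
  rw [← eq_add_sum_smul_single] at h1
  rw [mem_generator_graph]
  change HasDerivAt (fun t : ℝ => V.toFun (t • velocity v) ξ) _ _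
  refine h1.congr_deriv ?_
  have e : ∀ j, Complex.I • (((v j : ℝ) : ℂ) • z j) = v j • Complex.I • z j := fun j => by
    rw [smul_comm, Complex.coe_smul]
  rw [← h, smul_comm Complex.I, Complex.coe_smul, smul_add Complex.I, Finset.smul_sum, one_smul]
  simp_rw [e]

/-- The smeared vectors form a common core: `(R n ξ, R n x)` lies in the graph before closure and
tends to `(ξ, x)`. -/
lemma movingHamiltonian_eq (v : EuclideanSpace ℝ (Fin s)) :
    V.movingHamiltonian v = (V.along (velocity v)).generator := by
  have hcl := (V.along (velocity v)).isClosed_generator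
  have hle := V.preMovingHamiltonian_le v
  have hg := (hcl.isClosable.leIsClosable hle).graph_closure_eq_closure_graph
  refine LinearPMap.eq_of_eq_graph ?_
  change (V.preMovingHamiltonian v).closure.graph = _
  rw [← hg]
  refine le_antisymm ?_ ?_
  · exact Submodule.topologicalClosure_minimal _ (LinearPMap.le_graph_of_le hle) hcl
  · obtain ⟨R, hR, hd, -, hlim⟩ := V.exists_smoothing
    have hcomm : ∀ n x ξ, R n (V.toFun x ξ) = V.toFun x (R n ξ) := fun n x ξ =>
      (DFunLike.congr_fun (hR n (V.toFun x) fun y => by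
        rw [← V.map_add, ← V.map_add, add_comm]) ξ).symm
    rintro ⟨ξ, x⟩ hx
    change (ξ, x) ∈ closure ((V.preMovingHamiltonian v).graph : Set (E × E))
    refine mem_closure_of_tendsto ((hlim ξ).prodMk_nhds (hlim x))
      (Eventually.of_forall fun n => ?_)
    have hdiff : ∀ a, ∃ y, (R n ξ, y) ∈ (V.along a).generator.graph := fun a => by
      rw [← LinearPMap.mem_domain_iff]
      have : DifferentiableAt ℝ (fun t : ℝ => V.toFun (t • a) (R n ξ)) 0 :=
        ((hd n ξ).comp (g := fun x => V.toFun x (R n ξ)) (f := fun t : ℝ => t • a)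
          (by fun_prop)) 0
      exact this
    obtain ⟨y, hy⟩ := hdiff (1, 0)
    choose z hz using fun j : Fin s => hdiff (0, EuclideanSpace.single j 1)
    have h1 := V.mem_preMovingHamiltonian_graph (v := v) (p := (R n ξ, _)).2 ⟨y, z, hy, hz, rfl⟩
    have h2 := LinearPMap.le_graph_of_le hle h1
    have h3 : (R n ξ, R n x) ∈ (V.along (velocity v)).generator.graph := by
      rw [mem_generator_graph] at hx ⊢
      have := (V.along (velocity v)).hasDerivAt_comp (fun t ξ => hcomm n _ ξ) hx
      rwa [_root_.map_smul] at this
    rw [SetLike.mem_coe, LinearPMap.mem_graph_snd_inj _ h3 h2 rfl]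
    exact h1

lemma apply_eq_of_mem_graph {Ω : E} (hH : (Ω, (0 : E)) ∈ V.hamiltonian.graph)
    (hP : ∀ j, (Ω, (0 : E)) ∈ (V.momentum j).graph) (x : ℝ × EuclideanSpace ℝ (Fin s)) :
    V.toFun x Ω = Ω := by
  have hH' : HasDerivAt (fun t : ℝ => V.toFun (t • (1, 0)) Ω) (Complex.I • (0 : E)) 0 :=
    (mem_generator_graph _).1 hH
  have hP' : ∀ j, HasDerivAt (fun t : ℝ => V.toFun (t • (0, EuclideanSpace.single j 1)) Ω)
      (Complex.I • (0 : E)) 0 := fun j => (mem_generator_graph _).1 (hP j)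
  have h := V.hasDerivAt_along_add (V.hasDerivAt_along_smul x.1 hH')
    (V.hasDerivAt_along_sum Finset.univ fun j _ => V.hasDerivAt_along_smul (x.2 j) (hP' j))
  rw [← eq_add_sum_smul_single] at h
  simp only [smul_zero, Finset.sum_const_zero, add_zero, Prod.mk.eta] at h
  simpa [along_toFun] using (V.along x).apply_eq_of_hasDerivAt_zero h 1

end UnitaryRep

/-! ### Linear response to a step cycle -/

lemma deriv_nonneg_of_forall_integral_nonneg {g : ℝ → ℝ} {m : ℝ} (hg : Continuous g)
    (hm : HasDerivAt g m 0) (h : ∀ c, 0 ≤ ∫ r in (0 : ℝ)..c, g r) : 0 ≤ m := by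
  set F : ℝ → ℝ := fun c => ∫ r in (0 : ℝ)..c, g r with hF
  have hd : ∀ c, HasDerivAt F (g c) c := fun c =>
    intervalIntegral.integral_hasDerivAt_right (hg.intervalIntegrable 0 c)
      hg.aestronglyMeasurable.stronglyMeasurableAtFilter hg.continuousAt
  have hF0 : F 0 = 0 := by simp [hF]
  have hdF : deriv F = g := funext fun c => (hd c).deriv
  have hmin : IsLocalMin F 0 := Eventually.of_forall fun c => by rw [hF0]; exact h c
  by_contra! hneg
  -- With `m < 0` the minimum at `0` would also be a maximum, so `F` would be locally constant and
  -- `m = 0`.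
  have hmax : IsLocalMax F 0 := isLocalMax_of_deriv_deriv_neg (by rwa [hdF, hm.deriv])
    hmin.deriv_eq_zero (hd 0).continuousAt
  have hz : F =ᶠ[𝓝 0] fun _ => 0 := by
    filter_upwards [hmin, hmax] with c h1 h2
    rw [← hF0]
    exact le_antisymm h2 h1
  have h2 := hz.deriv.deriv_eq
  rw [hdF, hm.deriv] at h2
  simp at h2
  exact hneg.ne h2

/-- The unitary group `exp (-i s B)`. -/
noncomputable def expGroup (B : E →L[ℂ] E) (r : ℝ) : E →L[ℂ] E :=
  NormedSpace.exp (r • (-Complex.I • B))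

lemma hasDerivAt_expGroup (B : E →L[ℂ] E) (r : ℝ) :
    HasDerivAt (expGroup B) ((-Complex.I • B) * expGroup B r) r :=
  hasDerivAt_exp_smul_const' (𝕂 := ℝ) (-Complex.I • B) r

lemma expGroup_zero (B : E →L[ℂ] E) : expGroup B 0 = 1 := by
  simp [expGroup, NormedSpace.exp_zero]

lemma expGroup_mem_unitary {B : E →L[ℂ] E} (hB : IsSelfAdjoint B) (r : ℝ) :
    expGroup B r ∈ unitary (E →L[ℂ] E) := by
  let +nondep : NormedAlgebra ℚ (E →L[ℂ] E) := NormedAlgebra.restrictScalars ℚ ℂ _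
  refine NormedSpace.exp_mem_unitary_of_mem_skewAdjoint ?_
  refine skewAdjoint.smul_mem r ?_
  rw [skewAdjoint.mem_iff, star_smul, hB.star_eq]
  simp

lemma continuous_expGroup (B : E →L[ℂ] E) : Continuous (expGroup B) :=
  continuous_iff_continuousAt.2 fun r => (hasDerivAt_expGroup B r).continuousAt

lemma commute_expGroup (B : E →L[ℂ] E) (r : ℝ) : Commute B (expGroup B r) := by
  have h : Commute B (r • (-Complex.I • B)) := ((Commute.refl B).smul_right _).smul_right _
  exact h.exp_right

section SecondVariation

variable (U : UnitaryRep ℝ E) (B : E →L[ℂ] E)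

/-- The evolution `t ↦ U(-t) B U(t)`. -/
noncomputable def heisenberg (t : ℝ) : E →L[ℂ] E := U.toFun (-t) * B * U.toFun t

lemma heisenberg_apply (t : ℝ) (ξ : E) :
    heisenberg U B t ξ = U.toFun (-t) (B (U.toFun t ξ)) := rfl

lemma heisenberg_add (t r : ℝ) :
    heisenberg U B (t + r) = U.toFun (-t) * heisenberg U B r * U.toFun t := by
  ext ξ
  simp only [heisenberg, mul_apply_eq_comp]
  rw [add_comm t r, U.add_apply r t, ← U.add_apply (-t) (-r), neg_add_rev]

lemma isSelfAdjoint_heisenberg {B : E →L[ℂ] E} (hB : IsSelfAdjoint B) (t : ℝ) :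
    IsSelfAdjoint (heisenberg U B t) := by
  rw [isSelfAdjoint_iff, heisenberg, star_mul, star_mul, U.star_toFun, U.star_toFun, hB.star_eq,
    neg_neg, mul_assoc]

variable {U B} {δ : E →L[ℂ] E}

lemma hasDerivAt_heisenberg (h : HasDerivAt (heisenberg U B) δ 0) (t : ℝ) :
    HasDerivAt (heisenberg U B) (U.toFun (-t) * δ * U.toFun t) t := by
  have h0 : HasDerivAt (heisenberg U B) δ (t - t) := by rwa [sub_self]
  have h1 := ((h0.comp_sub_const t t).const_mul (U.toFun (-t))).mul_const (U.toFun t)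
  refine h1.congr_of_eventuallyEq (Eventually.of_forall fun r => ?_)
  change _ = U.toFun (-t) * heisenberg U B (r - t) * U.toFun t
  rw [← heisenberg_add, add_sub_cancel]

/-- The cycle `t ↦ c f'(t) U(-t) B U(t)` for a smooth step function `f` from `0` to `1`. -/
noncomputable def stepCycle (U : UnitaryRep ℝ E) (B : E →L[ℂ] E) (c t : ℝ) : E →L[ℂ] E :=
  (c * deriv Real.smoothTransition t) • heisenberg U B t

lemma contDiff_deriv_smoothTransition : ContDiff ℝ 1 (deriv Real.smoothTransition) :=
  ((contDiff_succ_iff_deriv (n := 1)).1 (Real.smoothTransition.contDiff (n := 2))).2.2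

lemma deriv_smoothTransition_eq_zero {t : ℝ} (ht : t ∉ Set.Ioo (0 : ℝ) 1) :
    deriv Real.smoothTransition t = 0 := by
  rw [Set.mem_Ioo, not_and_or, not_lt, not_lt] at ht
  rcases ht with ht | ht
  · refine IsLocalMin.deriv_eq_zero (Eventually.of_forall fun r => ?_)
    rw [Real.smoothTransition.zero_of_nonpos ht]
    exact Real.smoothTransition.nonneg r
  · refine IsLocalMax.deriv_eq_zero (Eventually.of_forall fun r => ?_)
    rw [Real.smoothTransition.one_of_one_le ht]
    exact Real.smoothTransition.le_one r

lemma heisenberg_mem {M : VonNeumannAlgebra E} (hU : ∀ t, U.toFun t ∈ M) (hBM : B ∈ M) (t : ℝ) :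
    heisenberg U B t ∈ M :=
  mul_mem (mul_mem (hU _) hBM) (hU t)

lemma smul_mem_vonNeumannAlgebra (M : VonNeumannAlgebra E) (c : ℂ) {A : E →L[ℂ] E} (hA : A ∈ M) :
    c • A ∈ M :=
  M.toStarSubalgebra.smul_mem (x := A) hA c

lemma isCycle_stepCycle {M : VonNeumannAlgebra E} (hU : ∀ t, U.toFun t ∈ M) (hBM : B ∈ M)
    (hB : IsSelfAdjoint B) (hC : ContDiff ℝ 1 (heisenberg U B)) (c : ℝ) :
    IsCycle M 1 (stepCycle U B c) := by
  refine ⟨fun t => ?_, fun t => ?_, ?_, fun t ht => ?_⟩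
  · rw [stepCycle, ← Complex.coe_smul]
    exact smul_mem_vonNeumannAlgebra M _ (heisenberg_mem hU hBM t)
  · exact (IsSelfAdjoint.all (c * deriv Real.smoothTransition t)).smul
      (isSelfAdjoint_heisenberg U hB t)
  · have h1 : ContDiff ℝ 1 fun t => c * deriv Real.smoothTransition t :=
      contDiff_const.mul contDiff_deriv_smoothTransition
    exact h1.smul hC
  · rw [stepCycle, deriv_smoothTransition_eq_zero fun h => ht (Set.Ioo_subset_Icc_self h)]
    simp

/-- In the interaction picture the cycle is `c f'(t) B`, a scalar function times one fixed operator,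
so no time ordering is needed. -/
lemma isPerturbedEvolution_stepCycle (hB : IsSelfAdjoint B) (c : ℝ) :
    IsPerturbedEvolution U (stepCycle U B c)
      (fun t => expGroup B (c * Real.smoothTransition t)) where
  mem_unitary t _ := expGroup_mem_unitary hB _
  initial := by simp [Real.smoothTransition.zero, expGroup_zero]
  hasDeriv ξ t _ := by
    have hf : HasDerivAt Real.smoothTransition (deriv Real.smoothTransition t) t :=
      ((Real.smoothTransition.contDiff (n := 1)).differentiable (by simp) t).hasDerivAt
    have h1 := (hasDerivAt_expGroup B (c * Real.smoothTransition t)).scomp t (hf.const_mul c)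
    have h2 := (((ContinuousLinearMap.apply ℂ E ξ).restrictScalars ℝ).hasFDerivAt.comp_hasDerivAt
      t h1).hasDerivWithinAt (s := Set.Ici 0)
    refine h2.congr_deriv ?_
    simp only [stepCycle, heisenberg_apply, ContinuousLinearMap.coe_restrictScalars',
      ContinuousLinearMap.apply_apply, smul_apply, mul_apply_eq_comp,
      UnitaryRep.apply_neg_apply]
    rw [← Complex.coe_smul, ← Complex.coe_smul, _root_.map_smul, U.apply_neg_apply, smul_comm]

/-- The derivative of the cycle has two terms. The one with `f''` has expectation proportional to
the constant `⟪Ω, BΩ⟫`, because `B` commutes with its exponential, and integrates to zero as `f'`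
vanishes at both ends. The other becomes the right side under `r = c f(t)`. -/
lemma work_stepCycle (hB : IsSelfAdjoint B) (h : HasDerivAt (heisenberg U B) δ 0) (Ω : E)
    (c : ℝ) :
    work U Ω 1 (stepCycle U B c) (fun t => expGroup B (c * Real.smoothTransition t)) =
      ∫ r in (0 : ℝ)..c, (⟪expGroup B r Ω, δ (expGroup B r Ω)⟫).re := by
  set f := Real.smoothTransition with hf_def
  have hf : ∀ t, HasDerivAt f (deriv f t) t := fun t =>
    ((Real.smoothTransition.contDiff (n := 1)).differentiable (by simp) t).hasDerivAt
  have hf' : ∀ t, HasDerivAt (deriv f) (deriv (deriv f) t) t := fun t =>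
    (contDiff_deriv_smoothTransition.differentiable (by simp) t).hasDerivAt
  have hf'' : Continuous (deriv (deriv f)) :=
    contDiff_deriv_smoothTransition.continuous_deriv (by simp)
  set g : ℝ → ℝ := fun r => (⟪expGroup B r Ω, δ (expGroup B r Ω)⟫).re with hg
  have hgc : Continuous g := by
    have h1 : Continuous fun r => expGroup B r Ω :=
      (continuous_expGroup B).clm_apply continuous_const
    exact Complex.continuous_re.comp (h1.inner (δ.continuous.comp h1))
  have hd : ∀ t, deriv (stepCycle U B c) t = (c * deriv f t) • (U.toFun (-t) * δ * U.toFun t)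
      + (c * deriv (deriv f) t) • heisenberg U B t := fun t =>
    (((hf' t).const_mul c).smul (hasDerivAt_heisenberg h t)).deriv
  have hint : ∀ t, (⟪U.toFun (-t) (expGroup B (c * f t) Ω),
      deriv (stepCycle U B c) t (U.toFun (-t) (expGroup B (c * f t) Ω))⟫).re =
      g (c * f t) * (c * deriv f t) + deriv (deriv f) t * (c * (⟪Ω, B Ω⟫).re) := fun t => by
    have hcomm : B (expGroup B (c * f t) Ω) = expGroup B (c * f t) (B Ω) :=
      DFunLike.congr_fun (commute_expGroup B (c * f t)).eq Ω
    rw [hd]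
    simp only [add_apply, smul_apply, mul_apply_eq_comp, heisenberg_apply,
      UnitaryRep.apply_neg_apply, inner_add_right]
    rw [← Complex.coe_smul, ← Complex.coe_smul, inner_smul_right, inner_smul_right,
      U.inner_apply_apply, U.inner_apply_apply, hcomm,
      ContinuousLinearMap.inner_map_map_of_mem_unitary (expGroup_mem_unitary hB _),
      Complex.add_re, Complex.re_ofReal_mul, Complex.re_ofReal_mul]
    ring
  unfold work
  simp_rw [hint]
  have hcf : Continuous fun t => c * f t := continuous_const.mul Real.smoothTransition.continuous
  have hcf' : Continuous fun t => c * deriv f t :=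
    continuous_const.mul contDiff_deriv_smoothTransition.continuous
  have hi1 : Continuous fun t => g (c * f t) * (c * deriv f t) := (hgc.comp hcf).mul hcf'
  have hi2 : Continuous fun t => deriv (deriv f) t * (c * (⟪Ω, B Ω⟫).re) :=
    hf''.mul continuous_const
  rw [intervalIntegral.integral_add (hi1.intervalIntegrable 0 1) (hi2.intervalIntegrable 0 1),
    intervalIntegral.integral_mul_const,
    intervalIntegral.integral_eq_sub_of_hasDerivAt (fun t _ => hf' t)
      (hf''.intervalIntegrable 0 1),
    deriv_smoothTransition_eq_zero (by simp), deriv_smoothTransition_eq_zero (by simp)]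
  have hs := intervalIntegral.integral_comp_mul_deriv (a := 0) (b := 1) (f := fun t => c * f t)
    (f' := fun t => c * deriv f t) (g := g) (fun t _ => (hf t).const_mul c)
    hcf'.continuousOn hgc
  simp only [Function.comp_apply] at hs
  rw [hs]
  simp [hf_def, Real.smoothTransition.zero, Real.smoothTransition.one]

/-- Linear response for passive states. -/
lemma IsPassive.im_inner_le {M : VonNeumannAlgebra E} {Ω : E} (hpass : IsPassive M Ω U.generator)
    (hU : ∀ t, U.toFun t ∈ M) (hBM : B ∈ M) (hB : IsSelfAdjoint B)
    (hC : ContDiff ℝ 1 (heisenberg U B)) (h : HasDerivAt (heisenberg U B) δ 0) :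
    (⟪B Ω, δ Ω⟫).im ≤ 0 := by
  have hδ : IsSelfAdjoint δ := by
    have h1 := h.star
    have e : star (heisenberg U B) = heisenberg U B :=
      funext fun t => (isSelfAdjoint_heisenberg U hB t).star_eq
    exact (h1.congr_of_eventuallyEq (Eventually.of_forall fun t =>
      ((isSelfAdjoint_heisenberg U hB t).star_eq).symm)).unique h
  -- Both signs of `c` are needed: they make `c = 0` an interior minimum of the work.
  have hwork : ∀ c, 0 ≤ ∫ r in (0 : ℝ)..c, (⟪expGroup B r Ω, δ (expGroup B r Ω)⟫).re := fun c => by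
    rw [← work_stepCycle hB h Ω c]
    simpa using hpass U rfl 1 _ _ one_pos (isCycle_stepCycle hU hBM hB hC c)
      (isPerturbedEvolution_stepCycle hB c)
  have hexp : ∀ r, HasDerivAt (fun r => expGroup B r Ω) (-Complex.I • B (expGroup B r Ω)) r :=
    fun r => ((ContinuousLinearMap.apply ℂ E Ω).restrictScalars ℝ).hasFDerivAt.comp_hasDerivAt
      r (hasDerivAt_expGroup B r)
  have hc : Continuous fun r => expGroup B r Ω :=
    continuous_iff_continuousAt.2 fun r => (hexp r).continuousAt
  have hderiv := Complex.reCLM.hasFDerivAt.comp_hasDerivAt (0 : ℝ) ((hexp 0).inner ℂ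
    ((δ.restrictScalars ℝ).hasFDerivAt.comp_hasDerivAt (0 : ℝ) (hexp 0)))
  have hres := deriv_nonneg_of_forall_integral_nonneg
    (Complex.continuous_re.comp (hc.inner (δ.continuous.comp hc))) hderiv hwork
  simp only [expGroup_zero, one_apply_eq_self, Function.comp_apply,
    ContinuousLinearMap.coe_restrictScalars', Complex.reCLM_apply] at hres
  -- Self-adjointness of `δ` makes the two terms of the derivative at `r = 0` complex conjugates.
  have hsym : ⟪Ω, δ (-Complex.I • B Ω)⟫ = ⟪δ Ω, -Complex.I • B Ω⟫ := by
    rw [← ContinuousLinearMap.adjoint_inner_left, ← ContinuousLinearMap.star_eq_adjoint,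
      hδ.star_eq]
  rw [hsym, Complex.add_re, ← inner_conj_symm (δ Ω), Complex.conj_re, inner_smul_left] at hres
  simp at hres
  linarith

end SecondVariation

/-! ### Positivity of the generator -/

namespace UnitaryRep

variable (U : UnitaryRep ℝ E)

/-- A bounded operator with range in the domain of the generator. -/
lemma exists_hasDerivAt_clm {R : E →L[ℂ] E}
    (hd : ∀ ξ, DifferentiableAt ℝ (fun t => U.toFun t (R ξ)) 0) :
    ∃ D : E →L[ℂ] E, ∀ ξ, HasDerivAt (fun t => U.toFun t (R ξ)) (D ξ) 0 := by
  have hlim : Tendsto (fun (t : ℝ) ξ => (((t⁻¹ : ℝ) : ℂ) • (U.toFun t * R - R)) ξ) (𝓝[≠] 0)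
      (𝓝 fun ξ => deriv (fun t => U.toFun t (R ξ)) 0) := by
    refine tendsto_pi_nhds.2 fun ξ => ?_
    have h := hasDerivAt_iff_tendsto_slope_zero.1 (hd ξ).hasDerivAt
    refine h.congr fun t => ?_
    change _ = ((t⁻¹ : ℝ) : ℂ) • (U.toFun t (R ξ) - R ξ)
    rw [Complex.coe_smul, zero_add, U.map_zero, one_apply_eq_self]
  -- Banach–Steinhaus: a pointwise limit of bounded operators is bounded.
  exact ⟨continuousLinearMapOfTendsto _ hlim, fun ξ => (hd ξ).hasDerivAt⟩

lemma contDiff_mul_mul {R S : E →L[ℂ] E} (hR : ∀ t ξ, R (U.toFun t ξ) = U.toFun t (R ξ))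
    (hdR : ∀ ξ, DifferentiableAt ℝ (fun t => U.toFun t (R ξ)) 0)
    (hdS : ∀ ξ, DifferentiableAt ℝ (fun t => U.toFun t (S ξ)) 0) :
    ContDiff ℝ 1 fun t => U.toFun t * (R * S) := by
  obtain ⟨D, hD⟩ := U.exists_hasDerivAt_clm hdR
  obtain ⟨D', hD'⟩ := U.exists_hasDerivAt_clm hdS
  -- One smoothing factor `R` makes `U t * R` Lipschitz in norm; the other, `S`, supplies the strong
  -- derivative `U t * R * D'`, which is then norm-continuous.
  have hlip : ∀ r t, ‖U.toFun r * R - U.toFun t * R‖ ≤ ‖D‖ * ‖r - t‖ := fun r t => by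
    refine ContinuousLinearMap.opNorm_le_bound _ (by positivity) fun ξ => ?_
    have h := convex_univ.norm_image_sub_le_of_norm_hasDerivWithin_le (C := ‖D‖ * ‖ξ‖)
      (fun r _ => (U.hasDerivAt_of_zero (hD ξ) r).hasDerivWithinAt (s := Set.univ))
      (fun r _ => by rw [U.norm_apply]; exact D.le_opNorm ξ) (Set.mem_univ t) (Set.mem_univ r)
    calc _ ≤ ‖D‖ * ‖ξ‖ * ‖r - t‖ := h
      _ = _ := by ring
  have hcont : Continuous fun t => U.toFun t * R := by
    rw [continuous_iff_continuousAt]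
    intro t
    rw [ContinuousAt, tendsto_iff_norm_sub_tendsto_zero]
    refine squeeze_zero (fun _ => norm_nonneg _) (fun r => hlip r t) ?_
    have hc : Continuous fun r : ℝ => ‖D‖ * ‖r - t‖ := by fun_prop
    simpa using hc.tendsto t
  have hcont' : Continuous fun t => U.toFun t * R * D' := hcont.mul continuous_const
  have hderiv : ∀ t, HasDerivAt (fun t => U.toFun t * (R * S)) (U.toFun t * R * D') t :=
    fun t => hasDerivAt_of_forall_apply hcont'
      (fun ξ t => U.hasDerivAt_of_zero (U.hasDerivAt_comp hR (hD' ξ)) t) t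
  rw [contDiff_one_iff_deriv]
  refine ⟨fun t => (hderiv t).differentiableAt, ?_⟩
  rwa [funext fun t => (hderiv t).deriv]

/-- A variant of the mean ergodic theorem. -/
lemma im_inner_nonneg_of_forall {ξ y : E} (h : HasDerivAt (fun t => U.toFun t ξ) y 0)
    (hpos : ∀ t, 0 ≤ (⟪ξ - U.toFun t ξ, y - U.toFun t y⟫).im) : 0 ≤ (⟪ξ, y⟫).im := by
  set q := (⟪ξ, y⟫).im with hq
  -- The derivative of `Φ` is the quantity in `hpos`. Hence `Φ` increases, while it differs from
  -- `2qt` by at most `2‖ξ‖²`.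
  let Φ : ℝ → ℝ := fun t => 2 * q * t - ((⟪ξ, U.toFun t ξ⟫).im - (⟪ξ, U.toFun (-t) ξ⟫).im)
  have h1 : ∀ t, HasDerivAt (fun t => (⟪ξ, U.toFun t ξ⟫).im) (⟪ξ, U.toFun t y⟫).im t := fun t =>
    (Complex.imCLM.hasFDerivAt.comp_hasDerivAt t
      (((innerSL ℂ ξ).restrictScalars ℝ).hasFDerivAt.comp_hasDerivAt t (U.hasDerivAt_of_zero h t)))
  have h2 : ∀ t, HasDerivAt (fun t => (⟪ξ, U.toFun (-t) ξ⟫).im) (-(⟪ξ, U.toFun (-t) y⟫).im) t :=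
    fun t => ((h1 (-t)).scomp t (hasDerivAt_neg t)).congr_deriv (by simp)
  have hΦ : ∀ t, HasDerivAt Φ
      (2 * q * 1 - ((⟪ξ, U.toFun t y⟫).im - -(⟪ξ, U.toFun (-t) y⟫).im)) t := fun t =>
    ((hasDerivAt_id t).const_mul (2 * q)).sub ((h1 t).sub (h2 t))
  have hmono : Monotone Φ := monotone_of_hasDerivAt_nonneg hΦ fun t => by
    have := hpos t
    simp only [inner_sub_left, inner_sub_right, U.inner_apply_apply, Complex.sub_im,
      U.inner_apply_left t ξ y] at this
    change 0 ≤ 2 * q * 1 - ((⟪ξ, U.toFun t y⟫).im - -(⟪ξ, U.toFun (-t) y⟫).im)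
    linarith
  have hbound : ∀ t, |(⟪ξ, U.toFun t ξ⟫).im| ≤ ‖ξ‖ ^ 2 := fun t => by
    refine (Complex.abs_im_le_norm _).trans ((norm_inner_le_norm _ _).trans (le_of_eq ?_))
    rw [U.norm_apply, sq]
  by_contra! hneg
  -- At this time `2qt = -2(‖ξ‖² + 1)`, beyond the reach of the bounded terms.
  have ht : 0 ≤ (‖ξ‖ ^ 2 + 1) / -q := div_nonneg (by positivity) (by linarith)
  have h3 := hmono ht
  have hqt : q * ((‖ξ‖ ^ 2 + 1) / -q) = -(‖ξ‖ ^ 2 + 1) := by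
    have hq0 : -q ≠ 0 := by linarith
    linarith [mul_div_cancel₀ (‖ξ‖ ^ 2 + 1) hq0, mul_div_cancel_left₀ (‖ξ‖ ^ 2 + 1) hq0,
      mul_div_assoc (-q) (‖ξ‖ ^ 2 + 1) (-q)]
  simp only [Φ, mul_assoc, hqt, neg_zero, mul_zero, sub_self, U.map_zero] at h3
  have h4 := abs_le.1 (hbound ((‖ξ‖ ^ 2 + 1) / -q))
  have h5 := abs_le.1 (hbound (-((‖ξ‖ ^ 2 + 1) / -q)))
  linarith

end UnitaryRep

/-- Second variation of a passive state in the direction `A + A*` when `A* Ω = 0`. -/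
lemma IsPassive.im_inner_nonneg {U : UnitaryRep ℝ E} {M : VonNeumannAlgebra E} {Ω : E}
    (hpass : IsPassive M Ω U.generator) (hU : ∀ t, U.toFun t ∈ M) (hΩ : ∀ t, U.toFun t Ω = Ω)
    {A : E →L[ℂ] E} (hA : A ∈ M) (hAΩ : star A Ω = 0) (hC : ContDiff ℝ 1 (heisenberg U A))
    {y : E} (hy : HasDerivAt (fun t => U.toFun t (A Ω)) y 0) : 0 ≤ (⟪A Ω, y⟫).im := by
  have hstar : heisenberg U (A + star A) = fun t => heisenberg U A t + star (heisenberg U A t) := by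
    funext t
    simp only [heisenberg, star_mul, U.star_toFun, neg_neg, mul_add, add_mul, mul_assoc]
  have hC' : ContDiff ℝ 1 (heisenberg U (A + star A)) := by
    rw [hstar]
    exact hC.add ((starL' ℝ (A := E →L[ℂ] E)).contDiff.comp hC)
  have hB : (A + star A) Ω = A Ω := by simp [hAΩ]
  have hderiv := (hC'.differentiable (by simp) 0).hasDerivAt
  have h := hpass.im_inner_le hU (add_mem hA (star_mem hA)) (IsSelfAdjoint.add_star_self A) hC'
    hderiv
  have h1 := ((ContinuousLinearMap.apply ℂ E Ω).restrictScalars ℝ).hasFDerivAt.comp_hasDerivAt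
    (0 : ℝ) hderiv
  have h2 : HasDerivAt (fun t : ℝ => U.toFun (-t) (A Ω)) (-y) 0 := by
    have hy' : HasDerivAt (fun t => U.toFun t (A Ω)) y (-0) := by rwa [neg_zero]
    simpa [Function.comp_def] using hy'.scomp (0 : ℝ) (hasDerivAt_neg 0)
  have h3 := h1.unique (h2.congr_of_eventuallyEq (Eventually.of_forall fun t => by
    simp [heisenberg_apply, hΩ, hAΩ]))
  simp only [ContinuousLinearMap.coe_restrictScalars', ContinuousLinearMap.apply_apply] at h3
  rw [h3, hB, inner_neg_right, Complex.neg_im] at h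
  linarith

/-- If the dynamics is inner, then the Hamiltonian is positive in every passive state. -/
lemma IsPassive.generator_nonneg {U : UnitaryRep ℝ E} {M : VonNeumannAlgebra E} {Ω : E}
    (hpass : IsPassive M Ω U.generator) (hcyc : IsCyclic M Ω) (hU : ∀ t, U.toFun t ∈ M)
    (hΩ : ∀ t, U.toFun t Ω = Ω) {R : ℕ → E →L[ℂ] E} (hRM : ∀ n, R n ∈ M)
    (hR : ∀ n t ξ, R n (U.toFun t ξ) = U.toFun t (R n ξ))
    (hd : ∀ n ξ, DifferentiableAt ℝ (fun t => U.toFun t (R n ξ)) 0) (hRΩ : ∀ n, R n Ω = Ω)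
    (hlim : ∀ ξ, Tendsto (fun n => R n ξ) atTop (𝓝 ξ)) {ξ y : E}
    (h : HasDerivAt (fun t => U.toFun t ξ) y 0) : 0 ≤ (⟪ξ, y⟫).im := by
  refine U.im_inner_nonneg_of_forall h fun t => ?_
  choose D hD using fun n => U.exists_hasDerivAt_clm (hd n)
  -- Invariance of `Ω` gives `Q* Ω = 0`, and `Q ∈ M` because the dynamics is inner.
  set Q : E →L[ℂ] E := 1 - U.toFun t with hQ
  have hQM : Q ∈ M := sub_mem (one_mem M) (hU t)
  have hQU : ∀ r ξ, Q (U.toFun r ξ) = U.toFun r (Q ξ) := fun r ξ => by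
    simp [hQ, U.apply_comm t r]
  have hQΩ : star Q Ω = 0 := by simp [hQ, U.star_toFun, hΩ]
  have hcontDiff : ∀ m n, ContDiff ℝ 1 fun r => U.toFun r * (R m * R n) := fun m n =>
    U.contDiff_mul_mul (hR m) (hd m) (hd n)
  have h1 : ∀ m n, ∀ C ∈ M, 0 ≤ (⟪Q (R m (R n (C Ω))), Q (R m (D n (C Ω)))⟫).im := by
    intro m n C hC
    -- Smoothing on both sides of `C` makes `U(-r) A U(r)` C¹ in norm; the right factor disappears
    -- on `Ω`.
    have hA : Q * (R m * R n) * C * (R m * R n) ∈ M :=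
      mul_mem (mul_mem (mul_mem hQM (mul_mem (hRM m) (hRM n))) hC) (mul_mem (hRM m) (hRM n))
    have hheis : heisenberg U (Q * (R m * R n) * C * (R m * R n)) = fun r =>
        Q * (U.toFun (-r) * (R m * R n)) * C * (U.toFun r * (R m * R n)) := by
      funext r
      ext ξ
      simp only [heisenberg, mul_apply_eq_comp, hR, hQU]
    have hcd : ContDiff ℝ 1 (heisenberg U (Q * (R m * R n) * C * (R m * R n))) := by
      rw [hheis]
      exact ((contDiff_const.mul ((hcontDiff m n).comp contDiff_neg)).mul contDiff_const).mul
        (hcontDiff m n)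
    have hA0 : star (Q * (R m * R n) * C * (R m * R n)) Ω = 0 := by
      simp only [star_mul, mul_apply_eq_comp, hQΩ, _root_.map_zero]
    have hAΩ : (Q * (R m * R n) * C * (R m * R n)) Ω = Q (R m (R n (C Ω))) := by
      simp [hRΩ]
    have := hpass.im_inner_nonneg hU hΩ hA hA0 hcd (y := Q (R m (D n (C Ω)))) (by
      rw [hAΩ]
      exact U.hasDerivAt_comp hQU (U.hasDerivAt_comp (hR m) (hD n (C Ω))))
    rwa [hAΩ] at this
  have h2 : ∀ m n ζ, 0 ≤ (⟪Q (R m (R n ζ)), Q (R m (D n ζ))⟫).im := by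
    intro m n ζ
    have hcl : IsClosed {ζ | 0 ≤ (⟪Q (R m (R n ζ)), Q (R m (D n ζ))⟫).im} :=
      isClosed_le continuous_const (Complex.continuous_im.comp
        (Continuous.inner (by fun_prop) (by fun_prop)))
    refine (hcl.closure_subset_iff.2 ?_) (hcyc ζ)
    rintro _ ⟨C, hC, rfl⟩
    exact h1 m n C hC
  -- Only `m → ∞` here: `D n` need not converge on a general `ζ`, but on `ξ` it equals `R n y`, so
  -- `n → ∞` is then possible.
  have h3 : ∀ n ζ, 0 ≤ (⟪Q (R n ζ), Q (D n ζ)⟫).im := fun n ζ =>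
    ge_of_tendsto' ((Complex.continuous_im.tendsto _).comp
      (((Q.continuous.tendsto _).comp (hlim (R n ζ))).inner
        ((Q.continuous.tendsto _).comp (hlim (D n ζ))))) fun m => h2 m n ζ
  have h4 : ∀ n, D n ξ = R n y := fun n => (hD n ξ).unique (U.hasDerivAt_comp (hR n) h)
  have h5 : 0 ≤ (⟪Q ξ, Q y⟫).im :=
    ge_of_tendsto' ((Complex.continuous_im.tendsto _).comp
      (((Q.continuous.tendsto _).comp (hlim ξ)).inner
        ((Q.continuous.tendsto _).comp (hlim y)))) fun n => by
          have := h3 n ξ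
          rwa [h4] at this
  simpa [hQ] using h5

/-! ### Spectral measures and vectors of negative energy -/

namespace ProjectionValuedMeasure

variable {X : Type*} [MeasurableSpace X] (F : ProjectionValuedMeasure X E)

lemma scalarMeasure_apply (ξ : E) {S : Set X} (hS : MeasurableSet S) :
    F.scalarMeasure ξ S = ENNReal.ofReal (⟪ξ, F.proj S ξ⟫).re :=
  Measure.ofMeasurable_apply S hS

instance (ξ : E) : IsFiniteMeasure (F.scalarMeasure ξ) :=
  ⟨by rw [F.scalarMeasure_apply ξ MeasurableSet.univ]; exact ENNReal.ofReal_lt_top⟩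

lemma scalarMeasure_real_univ (ξ : E) : (F.scalarMeasure ξ).real Set.univ = ‖ξ‖ ^ 2 := by
  rw [measureReal_def, F.scalarMeasure_apply ξ MeasurableSet.univ, F.proj_univ,
    one_apply_eq_self]
  have e : (⟪ξ, ξ⟫).re = ‖ξ‖ ^ 2 := inner_self_eq_norm_sq (𝕜 := ℂ) ξ
  rw [e, ENNReal.toReal_ofReal (by positivity)]

lemma ae_mem_of_proj_eq {ξ : E} {S : Set X} (hS : MeasurableSet S) (h : F.proj S ξ = ξ) :
    ∀ᵐ x ∂F.scalarMeasure ξ, x ∈ S := by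
  change F.scalarMeasure ξ Sᶜ = 0
  have h0 : F.proj Sᶜ ξ = 0 := by
    have h1 := DFunLike.congr_fun (F.proj_inter Sᶜ S hS.compl hS) ξ
    rw [Set.compl_inter_self, F.proj_empty, mul_apply_eq_comp, h] at h1
    simpa using h1.symm
  rw [F.scalarMeasure_apply ξ hS.compl, h0]
  simp

end ProjectionValuedMeasure

lemma exists_velocity_of_notMem_forwardCone {s : ℕ} {p : ℝ × EuclideanSpace ℝ (Fin s)}
    (hp : p ∉ forwardCone s) :
    ∃ v : EuclideanSpace ℝ (Fin s), ‖v‖ < 1 ∧ p.1 + ∑ j, v j * p.2 j < 0 := by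
  rcases lt_or_ge p.1 0 with h0 | h0
  · exact ⟨0, by simp, by simpa using h0⟩
  have h1 : p.1 ^ 2 < ‖p.2‖ ^ 2 := by
    by_contra! h
    exact hp ⟨h0, by linarith⟩
  have h2 : p.1 < ‖p.2‖ := lt_of_pow_lt_pow_left₀ 2 (norm_nonneg _) h1
  have hk : 0 < ‖p.2‖ := h0.trans_lt h2
  -- The speed is the midpoint of `p.1 / ‖p.2‖` and `1`, directed against the momentum.
  set c : ℝ := (p.1 / ‖p.2‖ + 1) / 2 with hc
  have h3 : p.1 / ‖p.2‖ < 1 := (div_lt_one hk).2 h2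
  have h4 : 0 ≤ p.1 / ‖p.2‖ := by positivity
  have hsum : ∑ j, p.2 j * p.2 j = ‖p.2‖ ^ 2 := by
    rw [EuclideanSpace.norm_sq_eq]
    simp [sq]
  refine ⟨(-(c / ‖p.2‖)) • p.2, ?_, ?_⟩
  · rw [norm_smul, norm_neg, Real.norm_of_nonneg (by positivity), div_mul_cancel₀ _ hk.ne']
    linarith
  · simp only [PiLp.smul_apply, smul_eq_mul, mul_assoc, ← Finset.mul_sum, hsum]
    have e : c / ‖p.2‖ * ‖p.2‖ ^ 2 = c * ‖p.2‖ := by field_simp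
    have e2 : p.1 / ‖p.2‖ * ‖p.2‖ = p.1 := div_mul_cancel₀ _ hk.ne'
    have e3 : c * ‖p.2‖ = (p.1 + ‖p.2‖) / 2 := by rw [hc]; linarith [e2]
    rw [neg_mul, e, e3]
    linarith

lemma IsJointSpectralMeasure.exists_mem_graph {s : ℕ}
    {V : UnitaryRep (ℝ × EuclideanSpace ℝ (Fin s)) E}
    {F : ProjectionValuedMeasure (ℝ × EuclideanSpace ℝ (Fin s)) E}
    (hF : IsJointSpectralMeasure V.hamiltonian V.momentum F) {p : ℝ × EuclideanSpace ℝ (Fin s)}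
    (hp : p ∈ F.support) {v : EuclideanSpace ℝ (Fin s)} (hv : ‖v‖ < 1)
    (hneg : p.1 + ∑ j, v j * p.2 j < 0) :
    ∃ ξ x : E, (ξ, x) ∈ (V.along (UnitaryRep.velocity v)).generator.graph ∧ (⟪ξ, x⟫).re < 0 := by
  set l : ℝ × EuclideanSpace ℝ (Fin s) → ℝ := fun q => q.1 + ∑ j, v j * q.2 j with hl
  have hlc : Continuous l := by fun_prop
  -- The half-space bounds `l` away from zero; the ball makes the coordinates bounded, so that `ξ`
  -- lies in every domain.
  set S := {q | l q < l p / 2} ∩ Metric.ball p 1 with hS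
  have hlp : l p < 0 := hneg
  have hSo : IsOpen S := (isOpen_lt hlc continuous_const).inter Metric.isOpen_ball
  have hSm : MeasurableSet S := hSo.measurableSet
  have hFS : F.proj S ≠ 0 := hp S hSo ⟨by change l p < l p / 2; linarith, by simp⟩
  obtain ⟨ζ, hζ⟩ : ∃ ζ, F.proj S ζ ≠ 0 := by
    by_contra! h
    exact hFS (ContinuousLinearMap.ext h)
  set ξ := F.proj S ζ with hξ
  have hFξ : F.proj S ξ = ξ :=
    DFunLike.congr_fun (F.isStarProjection S hSm).isIdempotentElem.eq ζ
  have hae := F.ae_mem_of_proj_eq hSm hFξ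
  have hint : ∀ g : ℝ × EuclideanSpace ℝ (Fin s) → ℝ, Continuous g →
      Integrable g (F.scalarMeasure ξ) := fun g hg => by
    obtain ⟨C, hC⟩ := (isCompact_closedBall p 1).exists_bound_of_continuousOn hg.continuousOn
    exact Integrable.of_bound hg.aestronglyMeasurable C
      (hae.mono fun q hq => hC q (Metric.ball_subset_closedBall hq.2))
  have hξH : ξ ∈ V.hamiltonian.domain := (hF.energy.1 ξ).2 (hint _ (by fun_prop))
  have hξP : ∀ j, ξ ∈ (V.momentum j).domain := fun j =>
    ((hF.momentum j).1 ξ).2 (hint _ (by fun_prop))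
  refine ⟨ξ, _, LinearPMap.le_graph_of_le (V.preMovingHamiltonian_le v)
    (V.mem_preMovingHamiltonian_graph.2 ⟨V.hamiltonian ⟨ξ, hξH⟩,
      fun j => V.momentum j ⟨ξ, hξP j⟩, V.hamiltonian.mem_graph ⟨ξ, hξH⟩,
      fun j => (V.momentum j).mem_graph ⟨ξ, hξP j⟩, rfl⟩), ?_⟩
  have hγ : 0 < 1 / Real.sqrt (1 - ‖v‖ ^ 2) := by
    refine one_div_pos.2 (Real.sqrt_pos.2 ?_)
    nlinarith [norm_nonneg v]
  have hHξ := hF.energy.2 ⟨ξ, hξH⟩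
  have hPξ := fun j => (hF.momentum j).2 ⟨ξ, hξP j⟩
  simp only at hHξ hPξ
  rw [inner_smul_right, Complex.re_ofReal_mul, inner_add_right, inner_sum, hHξ]
  simp_rw [inner_smul_right, hPξ]
  refine mul_neg_of_pos_of_neg hγ ?_
  norm_cast
  have hsum : ∫ q, l q ∂F.scalarMeasure ξ = (∫ q, q.1 ∂F.scalarMeasure ξ)
      + ∑ j, v j * ∫ q, q.2 j ∂F.scalarMeasure ξ := by
    rw [hl, integral_add (hint _ (by fun_prop)) (hint _ (by fun_prop)),
      integral_finsetSum _ fun j _ => hint _ (by fun_prop)]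
    simp_rw [integral_const_mul]
  rw [← hsum]
  calc ∫ q, l q ∂F.scalarMeasure ξ ≤ ∫ _, l p / 2 ∂F.scalarMeasure ξ :=
        integral_mono_ae (hint l hlc) (integrable_const _) (hae.mono fun q hq => hq.1.le)
    _ = ‖ξ‖ ^ 2 * (l p / 2) := by
        rw [integral_const, F.scalarMeasure_real_univ, smul_eq_mul]
    _ < 0 := mul_neg_of_pos_of_neg (by positivity) (by linarith)

end Passivity

/-! ### The spectrum condition -/

open Passivity
theorem proposition3 {E : Type*} [NormedAddCommGroup E] [InnerProductSpace ℂ E] [CompleteSpace E]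
    (s : ℕ) (M : VonNeumannAlgebra E)
    (Ω : E) (hΩ : ‖Ω‖ = 1) (hcyc : IsCyclic M Ω)
    (V : UnitaryRep (ℝ × EuclideanSpace ℝ (Fin s)) E)
    (hH : (Ω, (0 : E)) ∈ V.hamiltonian.graph)
    (hP : ∀ j, (Ω, (0 : E)) ∈ (V.momentum j).graph)
    (hpassive : ∀ v : EuclideanSpace ℝ (Fin s), ‖v‖ < 1 → IsPassive M Ω (V.movingHamiltonian v))
    (hVM : ∀ x, V.toFun x ∈ M) :
    jointSpectrum V.hamiltonian V.momentum ⊆ forwardCone s := by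
  rintro p ⟨F, hF, hp⟩
  by_contra hcone
  obtain ⟨v, hv, hneg⟩ := exists_velocity_of_notMem_forwardCone hcone
  obtain ⟨ξ, x, hx, hlt⟩ := hF.exists_mem_graph hp hv hneg
  obtain ⟨R, hR, hd, hRΩ, hlim⟩ := V.exists_smoothing
  have hpass := hpassive v hv
  rw [V.movingHamiltonian_eq v] at hpass
  have hΩV := V.apply_eq_of_mem_graph hH hP
  have hRM : ∀ n, R n ∈ M := fun n => by
    rw [← M.commutant_commutant, VonNeumannAlgebra.mem_commutant_iff]
    intro C hC
    rw [VonNeumannAlgebra.mem_commutant_iff] at hC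
    exact hR n C fun y => (hC _ (hVM y)).symm
  have h := hpass.generator_nonneg hcyc (fun t => hVM _) (fun t => hΩV _) hRM
    (fun n t ξ => (DFunLike.congr_fun (hR n (V.toFun (t • UnitaryRep.velocity v)) fun y => by
      rw [← V.map_add, ← V.map_add, add_comm]) ξ).symm)
    (fun n ξ => ((hd n ξ).comp (g := fun x => V.toFun x (R n ξ))
      (f := fun t : ℝ => t • UnitaryRep.velocity v) (by fun_prop)) 0)
    (fun n => hRΩ n Ω hΩV) hlim ((UnitaryRep.mem_generator_graph _).1 hx)
  -- The derivative of the orbit is `i x`, so its imaginary part against `ξ` is the real part of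
  -- `⟪ξ, x⟫`.
  rw [inner_smul_right] at h
  simp at h
  linarith
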